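/- Let $W=(W_t)_{t\ge 0}$ be a standard one-dimensional Wiener process on a probability space $(\Omega,\mathcal F,\mathbb P)$ (started at $0$, with almost surely continuous paths), and let $\Phi$ be the distribution function of the standard normal law $N(0,1)$. Let $z<0<y$ and $t>0$. For $a\in\{y,z\}$ put $T_a=\inf\{s>0:\ W_s=a\}$ (with $\inf\emptyset=+\infty$), and let $\tau=\min(T_y,T_z)$. Then, all the series below being absolutely convergent: (1) for every $x$ with $z\le x\le y$, $$\begin{aligned}\mathbb P(W_t\le x,\ \tau\le t)={}&\mathbb P(W_\tau=z,\ \tau\le t)\\ &+\sum_{k=1}^\infty\left(\Phi\left(\frac{x+2(k-1)z-2ky}{\sqrt t}\right)-\Phi\left(\frac{x+2kz-2ky}{\sqrt t}\right)\right)\\ &-\sum_{k=1}^\infty\left(\Phi\left(\frac{-x+2kz-2(k-1)y}{\sqrt t}\right)-\Phi\left(\frac{-x+2kz-2ky}{\sqrt t}\right)\right);\end{aligned}$$ (2) $$\mathbb P(W_\tau=z,\ \tau\le t)=2\sum_{k=1}^\infty\left(\Phi\left(\frac{(2k-1)z-2(k-1)y}{\sqrt t}\right)-\Phi\left(\frac{(2k-1)z-2ky}{\sqrt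 t}\right)\right);$$ (3) $$\mathbb P(W_\tau=y,\ \tau\le t)=2\sum_{k=1}^\infty\left(\Phi\left(\frac{2(k-1)z-(2k-1)y}{\sqrt t}\right)-\Phi\left(\frac{2kz-(2k-1)y}{\sqrt t}\right)\right);$$ (4) consequently, the distribution function of the exit time $\tau$ from the interval $(z,y)$ is $$\begin{aligned}\mathbb P(\tau\le t)={}&2\sum_{k=1}^\infty\left(\Phi\left(\frac{(2k-1)z-2(k-1)y}{\sqrt t}\right)-\Phi\left(\frac{(2k-1)z-2ky}{\sqrt t}\right)\right)\\ &+2\sum_{k=1}^\infty\left(\Phi\left(\frac{2(k-1)z-(2k-1)y}{\sqrt t}\right)-\Phi\left(\frac{2kz-(2k-1)y}{\sqrt t}\right)\right).\end{aligned}$$ -/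

import Mathlib

open MeasureTheory ProbabilityTheory
open scoped NNReal

/-- The distribution function `Φ` of the standard normal law `N(0,1)`. -/
noncomputable def stdNormalCDF (x : ℝ) : ℝ :=
  cdf (gaussianReal 0 1) x

/-- The first passage time `T_a = inf {s > 0 : W_s = a}`, with values in `[0, ∞]`
(the infimum of the empty set is `⊤`). -/
noncomputable def firstPassageTime {Ω : Type*} (W : ℝ≥0 → Ω → ℝ) (a : ℝ) (ω : Ω) :
    WithTop ℝ≥0 :=
  sInf ((fun s : ℝ≥0 => (s : WithTop ℝ≥0)) '' {s : ℝ≥0 | 0 < s ∧ W s ω = a})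

/-- The two-barrier stopping time `τ = min (T_y, T_z)`. -/
noncomputable def twoBarrierTime {Ω : Type*} (W : ℝ≥0 → Ω → ℝ) (y z : ℝ) (ω : Ω) :
    WithTop ℝ≥0 :=
  min (firstPassageTime W y ω) (firstPassageTime W z ω)

/-- `k`-th term (`k ≥ 1`) of the first series in the formula for `P(W_t ≤ x, τ ≤ t)`. -/
noncomputable def upperTerm (t x y z : ℝ) (k : ℕ) : ℝ :=
  stdNormalCDF ((x + 2 * ((k : ℝ) - 1) * z - 2 * (k : ℝ) * y) / √t)
    - stdNormalCDF ((x + 2 * (k : ℝ) * z - 2 * (k : ℝ) * y) / √t)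

/-- `k`-th term (`k ≥ 1`) of the second series in the formula for `P(W_t ≤ x, τ ≤ t)`. -/
noncomputable def lowerTerm (t x y z : ℝ) (k : ℕ) : ℝ :=
  stdNormalCDF ((-x + 2 * (k : ℝ) * z - 2 * ((k : ℝ) - 1) * y) / √t)
    - stdNormalCDF ((-x + 2 * (k : ℝ) * z - 2 * (k : ℝ) * y) / √t)

/-- `k`-th term (`k ≥ 1`) of the series for the exit through the lower barrier `z`. -/
noncomputable def lowerExitTerm (t y z : ℝ) (k : ℕ) : ℝ :=
  stdNormalCDF (((2 * (k : ℝ) - 1) * z - 2 * ((k : ℝ) - 1) * y) / √t)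
    - stdNormalCDF (((2 * (k : ℝ) - 1) * z - 2 * (k : ℝ) * y) / √t)

/-- `k`-th term (`k ≥ 1`) of the series for the exit through the upper barrier `y`. -/
noncomputable def upperExitTerm (t y z : ℝ) (k : ℕ) : ℝ :=
  stdNormalCDF ((2 * ((k : ℝ) - 1) * z - (2 * (k : ℝ) - 1) * y) / √t)
    - stdNormalCDF ((2 * (k : ℝ) * z - (2 * (k : ℝ) - 1) * y) / √t)

/-! The proof is an inclusion–exclusion over alternating visits to the two barriers. Let `Z n` be
the event that the path runs through the alternating word `altList a b n` by time `t`; the head of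
the word is the latest visit. Lengthening the word adds an earlier visit at its end. On the event
`A` that `a` is met before `b` and by time `t`, an earliest visit to `b` can always be preceded by
one to `a`, so `Z (2m)` and `Z (2m+1)` agree on `A`; off `A` the roles are exchanged, and `Z (2m+1)`
and `Z (2m+2)` agree. Hence `P (Z (2m+1)) - P (Z (2m+2))` telescopes to `P A`, also after
intersection with an event on `W t` (`hasSum_measureReal_hitsFirst`).

The probabilities of the words are Gaussian. By the reflection principle at the latest visit
(`measureReal_hitsBy_reflect`), the side of that barrier on which `W t` lies can be switched; on the
far side, the visit is forced by continuity and can be dropped from the word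
(`hitsBy_cons_altList_iff`). Iteration reduces everything to values of the normal distribution
function, shifted by `2 (y - z)` for every two letters.

The reflection principle is obtained without the strong Markov property: the passage time is rounded
up to a finite grid, independence of increments is used at each grid point, and the mesh tends to
`0`. -/

/-- `hitsBy f [cₙ, …, c₁] u`: the path `f` takes the values `c₁, …, cₙ` at times
`s₁ ≤ … ≤ sₙ ≤ u`. -/
def hitsBy (f : ℝ≥0 → ℝ) : List ℝ → ℝ≥0 → Prop
  | [], _ => True
  | c :: l, u => ∃ s ≤ u, f s = c ∧ hitsBy f l s

/-! ### Deterministic paths: successive visits, and which barrier comes first. -/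

section Path

variable {f : ℝ≥0 → ℝ} {l : List ℝ} {c : ℝ} {u v : ℝ≥0}

lemma hitsBy.mono (h : hitsBy f l u) (huv : u ≤ v) : hitsBy f l v := by
  cases l with
  | nil => trivial
  | cons c l =>
    obtain ⟨s, hs, h⟩ := h
    exact ⟨s, hs.trans huv, h⟩

/-- The times at which `f` takes the value `c` after having passed through the values in `l`. -/
def hitTimes (f : ℝ≥0 → ℝ) (c : ℝ) (l : List ℝ) : Set ℝ≥0 := {s | f s = c ∧ hitsBy f l s}

/-- Nonemptiness is a separate conjunct because `sInf ∅ = 0` in `ℝ≥0`. -/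
lemma hitsBy_cons_iff_of_isClosed (hK : IsClosed (hitTimes f c l)) :
    hitsBy f (c :: l) u ↔ (hitTimes f c l).Nonempty ∧ sInf (hitTimes f c l) ≤ u := by
  constructor
  · rintro ⟨s, hs, h⟩
    exact ⟨⟨s, h⟩, (csInf_le (OrderBot.bddBelow (hitTimes f c l)) h).trans hs⟩
  · rintro ⟨hne, hle⟩
    exact ⟨_, hle, hK.csInf_mem hne (OrderBot.bddBelow _)⟩

lemma isClosed_hitsBy (hf : Continuous f) (l : List ℝ) : IsClosed {u | hitsBy f l u} := by
  induction l with
  | nil => simp [hitsBy]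
  | cons c l ih =>
    have hK : IsClosed (hitTimes f c l) := (isClosed_eq hf continuous_const).inter ih
    simp_rw [hitsBy_cons_iff_of_isClosed hK]
    by_cases h : (hitTimes f c l).Nonempty
    · simp only [h, true_and]
      exact isClosed_Ici
    · simp [h]

lemma isClosed_hitTimes (hf : Continuous f) (c : ℝ) (l : List ℝ) : IsClosed (hitTimes f c l) :=
  (isClosed_eq hf continuous_const).inter (isClosed_hitsBy hf l)

lemma hitsBy_cons_iff (hf : Continuous f) :
    hitsBy f (c :: l) u ↔ (hitTimes f c l).Nonempty ∧ sInf (hitTimes f c l) ≤ u :=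
  hitsBy_cons_iff_of_isClosed (isClosed_hitTimes hf c l)

lemma apply_sInf_hitTimes (hf : Continuous f) (h : (hitTimes f c l).Nonempty) :
    f (sInf (hitTimes f c l)) = c :=
  ((isClosed_hitTimes hf c l).csInf_mem h (OrderBot.bddBelow _)).1

/-- A countable description, needed for measurability. A dense time near the visit to `c` may
precede the visits in `l`, hence the slack `1 / (m + 1)`; the cut-off at `u` keeps the condition in
the past of `u`. Conversely, compactness of `[0, u]` gives a limit time, and closedness of `hitsBy`
passes to it. -/
lemma hitsBy_cons_iff_denseSeq (hf : Continuous f) :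
    hitsBy f (c :: l) u ↔ ∀ m : ℕ, ∃ n : ℕ,
      |f (TopologicalSpace.denseSeq (Set.Iic u) n) - c| < 1 / ((m : ℝ) + 1) ∧
      hitsBy f l (min (TopologicalSpace.denseSeq (Set.Iic u) n + 1 / ((m : ℝ≥0) + 1)) u) := by
  constructor
  · rintro ⟨s, hs, hfs, hl⟩ m
    have hm : (0 : ℝ) < 1 / ((m : ℝ) + 1) := by positivity
    have hopen : IsOpen {r : Set.Iic u | |f r - c| < 1 / ((m : ℝ) + 1) ∧
        s < r + 1 / ((m : ℝ≥0) + 1)} := by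
      apply IsOpen.and
      · exact isOpen_lt (by fun_prop) continuous_const
      · exact isOpen_lt continuous_const (by fun_prop)
    obtain ⟨r, hr, n, rfl⟩ := (TopologicalSpace.denseRange_denseSeq (Set.Iic u)).inter_open_nonempty
      _ hopen ⟨⟨s, hs⟩, by simpa [hfs] using hm, by
        exact lt_add_of_pos_right _ (by positivity)⟩
    exact ⟨n, hr.1, hl.mono (le_min hr.2.le hs)⟩
  · intro h
    choose n h1 h2 using h
    obtain ⟨s, hs, φ, hφ, hlim⟩ := (isCompact_Icc (a := (0 : ℝ≥0)) (b := u)).tendsto_subseq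
      (x := fun m => (TopologicalSpace.denseSeq (Set.Iic u) (n m) : ℝ≥0))
      (fun m => ⟨zero_le, (TopologicalSpace.denseSeq (Set.Iic u) (n m)).2⟩)
    have hinv : Filter.Tendsto (fun m : ℕ => 1 / ((φ m : ℝ) + 1)) Filter.atTop (nhds 0) :=
      tendsto_one_div_add_atTop_nhds_zero_nat.comp hφ.tendsto_atTop
    have hinv' : Filter.Tendsto (fun m : ℕ => 1 / ((φ m : ℝ≥0) + 1)) Filter.atTop (nhds 0) := by
      rw [← NNReal.tendsto_coe]
      simpa using hinv
    refine ⟨s, hs.2, ?_, ?_⟩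
    · have h3 : Filter.Tendsto
          (fun m => |f (TopologicalSpace.denseSeq (Set.Iic u) (n (φ m))) - c|)
          Filter.atTop (nhds |f s - c|) :=
        (((hf.tendsto s).comp hlim).sub_const c).abs
      have := le_of_tendsto_of_tendsto' h3 hinv fun m => (h1 (φ m)).le
      exact sub_eq_zero.1 (abs_nonpos_iff.1 this)
    · refine (isClosed_hitsBy hf l).mem_of_tendsto ((hlim.add hinv').min (tendsto_const_nhds
        (x := u))) (.of_forall fun m => h2 (φ m)) |>.mono ?_
      simp

lemma hitsBy_of_append {l' : List ℝ} (h : hitsBy f (l ++ l') u) : hitsBy f l u := by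
  induction l generalizing u with
  | nil => trivial
  | cons c l ih =>
    obtain ⟨s, hs, hc, h⟩ := h
    exact ⟨s, hs, hc, ih h⟩

lemma exists_of_hitsBy_append_singleton (h : hitsBy f (l ++ [c]) u) : ∃ s ≤ u, f s = c := by
  induction l generalizing u with
  | nil => obtain ⟨s, hs, hc, -⟩ := h; exact ⟨s, hs, hc⟩
  | cons c l ih =>
    obtain ⟨s, hs, -, h⟩ := h
    obtain ⟨r, hr, h⟩ := ih h
    exact ⟨r, hr.trans hs, h⟩

/-- The path `f` takes the value `a` by time `t`, and not after the value `b`. -/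
def hitsFirst (f : ℝ≥0 → ℝ) (a b : ℝ) (t : ℝ≥0) : Prop :=
  ∃ s ≤ t, f s = a ∧ ∀ r, f r = b → s ≤ r

/-- The last entry of a list is the earliest visit, so a visit to `a` that precedes every visit to
`b` can be put before it. -/
lemma hitsFirst.append {a b : ℝ} {t : ℝ≥0} (h : hitsFirst f a b t) (hl : hitsBy f (l ++ [b]) u) :
    hitsBy f (l ++ [b] ++ [a]) u := by
  induction l generalizing u with
  | nil =>
    obtain ⟨s, -, hs, h⟩ := h
    obtain ⟨r, hr, hb, -⟩ := hl
    exact ⟨r, hr, hb, s, h r hb, hs, trivial⟩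
  | cons c l ih =>
    obtain ⟨s, hs, hc, h'⟩ := hl
    exact ⟨s, hs, hc, ih h'⟩

lemma hitsFirst_or_hitsFirst {a b : ℝ} {s t : ℝ≥0} (hf : Continuous f) (hst : s ≤ t)
    (hs : f s = a) :
    hitsFirst f a b t ∨ hitsFirst f b a t := by
  have hc : IsClosed {r | f r = a} := isClosed_eq hf continuous_const
  have h1 := hc.csInf_mem ⟨s, hs⟩ (OrderBot.bddBelow _)
  have h2 : ∀ r, f r = a → sInf {r | f r = a} ≤ r := fun r hr => csInf_le (OrderBot.bddBelow _) hr
  by_cases h : ∀ r, f r = b → sInf {r | f r = a} ≤ r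
  · exact .inl ⟨_, (h2 s hs).trans hst, h1, h⟩
  · push Not at h
    obtain ⟨r, hr, hlt⟩ := h
    exact .inr ⟨r, hlt.le.trans ((h2 s hs).trans hst), hr, fun r' hr' => hlt.le.trans (h2 r' hr')⟩

lemma not_hitsFirst_of_hitsFirst {a b : ℝ} {t : ℝ≥0} (hab : a ≠ b) (h : hitsFirst f a b t) :
    ¬ hitsFirst f b a t := by
  rintro ⟨r, -, hr, h'⟩
  obtain ⟨s, -, hs, h⟩ := h
  have := le_antisymm (h r hr) (h' s hs)
  subst this
  exact hab (hs.symm.trans hr)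

/-- The alternating list `[a, b, a, …]` of length `n`. -/
def altList (a b : ℝ) : ℕ → List ℝ
  | 0 => []
  | n + 1 => a :: altList b a n

lemma altList_succ_eq_append (a b : ℝ) (n : ℕ) :
    altList a b (n + 1) = altList a b n ++ [if Even n then a else b] := by
  induction n generalizing a b with
  | zero => simp [altList]
  | succ n ih =>
    rw [altList, ih b a, altList]
    by_cases h : Even n <;> simp [h, Nat.even_add_one]

lemma hitsFirst.hitsBy_altList_iff {a b : ℝ} {t : ℝ≥0} (h : hitsFirst f a b t) (m : ℕ) :
    hitsBy f (altList a b (2 * m + 1)) t ↔ hitsBy f (altList a b (2 * m)) t := by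
  rw [altList_succ_eq_append, if_pos (even_two_mul m)]
  refine ⟨hitsBy_of_append, fun h' => ?_⟩
  cases m with
  | zero => obtain ⟨s, hs, ha, -⟩ := h; exact ⟨s, hs, ha, trivial⟩
  | succ m =>
    have : altList a b (2 * (m + 1)) = altList a b (2 * m + 1) ++ [b] := by
      rw [show 2 * (m + 1) = 2 * m + 1 + 1 by ring, altList_succ_eq_append a b (2 * m + 1),
        if_neg (by simp)]
    rw [this] at h' ⊢
    exact h.append h'

lemma hitsBy_altList_iff_of_not_hitsFirst {a b : ℝ} {t : ℝ≥0} (hf : Continuous f)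
    (h : ¬ hitsFirst f a b t) (m : ℕ) :
    hitsBy f (altList a b (2 * m + 2)) t ↔ hitsBy f (altList a b (2 * m + 1)) t := by
  rw [altList_succ_eq_append a b (2 * m + 1), if_neg (by simp)]
  refine ⟨hitsBy_of_append, fun h' => ?_⟩
  rw [altList_succ_eq_append, if_pos (even_two_mul m)] at h' ⊢
  obtain ⟨s, hs, hsa⟩ := exists_of_hitsBy_append_singleton h'
  exact ((hitsFirst_or_hitsFirst hf hs hsa).resolve_left h).append h'

/-- A start away from `a` makes the restriction to positive times void, and closedness of the level
set makes the infimum attained. -/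
lemma firstPassageTime_eq {Ω : Type*} {W : ℝ≥0 → Ω → ℝ} {a : ℝ} {ω : Ω}
    (hf : Continuous (W · ω)) (h0 : W 0 ω ≠ a) :
    (firstPassageTime W a ω = ⊤ ∧ ∀ s, W s ω ≠ a) ∨
    ∃ s : ℝ≥0, firstPassageTime W a ω = s ∧ W s ω = a ∧ ∀ r, W r ω = a → s ≤ r := by
  have hS : {s : ℝ≥0 | 0 < s ∧ W s ω = a} = {s | W s ω = a} := by
    ext s
    simp only [Set.mem_ofPred_eq, and_iff_right_iff_imp]
    rintro h
    exact pos_iff_ne_zero.2 fun h' => h0 (h' ▸ h)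
  rw [firstPassageTime, hS]
  by_cases hne : {s | W s ω = a}.Nonempty
  · refine .inr ⟨sInf {s | W s ω = a}, ?_, ?_⟩
    · rw [WithTop.coe_sInf' hne (OrderBot.bddBelow _)]
    · exact ⟨(isClosed_eq hf continuous_const).csInf_mem hne (OrderBot.bddBelow _),
        fun r hr => csInf_le (OrderBot.bddBelow _) hr⟩
  · rw [Set.not_nonempty_iff_eq_empty] at hne
    refine .inl ⟨by simp only [hne, Set.image_empty, WithTop.sInf_empty], fun s hs => ?_⟩
    exact (Set.eq_empty_iff_forall_notMem.1 hne s) hs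

lemma twoBarrierTime_comm {Ω : Type*} (W : ℝ≥0 → Ω → ℝ) (a b : ℝ) :
    twoBarrierTime W a b = twoBarrierTime W b a := by
  funext ω
  exact min_comm _ _

lemma stoppedValue_twoBarrierTime_iff {Ω : Type*} {W : ℝ≥0 → Ω → ℝ} {a b : ℝ} {ω : Ω} {t : ℝ≥0}
    (hf : Continuous (W · ω)) (ha : W 0 ω ≠ a) (hb : W 0 ω ≠ b) (hab : a ≠ b) :
    (stoppedValue W (twoBarrierTime W a b) ω = a ∧ twoBarrierTime W a b ω ≤ t) ↔
      hitsFirst (W · ω) a b t := by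
  simp only [stoppedValue, twoBarrierTime, hitsFirst]
  rcases firstPassageTime_eq hf ha with ⟨h1, h2⟩ | ⟨s, h1, h2, h3⟩ <;>
  rcases firstPassageTime_eq hf hb with ⟨k1, k2⟩ | ⟨r, k1, k2, k3⟩ <;> rw [h1, k1]
  · simp [h2]
  · simp [h2]
  · simp only [le_top, inf_of_le_left, WithTop.untopA_eq_untop WithTop.coe_ne_top, WithTop.untop_coe, h2, true_and, WithTop.coe_le_coe]
    exact ⟨fun h => ⟨s, h, h2, fun r hr => (k2 r hr).elim⟩, fun ⟨s', hs', h, _⟩ => (h3 s' h).trans hs'⟩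
  · rw [← WithTop.coe_min, WithTop.untopA_eq_untop WithTop.coe_ne_top, WithTop.untop_coe, WithTop.coe_le_coe]
    rcases le_total s r with hsr | hrs
    · rw [min_eq_left hsr]
      exact ⟨fun h => ⟨s, h.2, h2, fun r' hr' => hsr.trans (k3 r' hr')⟩,
        fun ⟨s', hs', h, _⟩ => ⟨h2, (h3 s' h).trans hs'⟩⟩
    · rw [min_eq_right hrs]
      refine ⟨fun h => (hab (h.1.symm.trans k2)).elim, fun ⟨s', _, h, h'⟩ => ?_⟩
      have : r = s := le_antisymm hrs ((h3 s' h).trans (h' r k2))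
      exact (hab (h2.symm.trans (this ▸ k2))).elim

lemma twoBarrierTime_le_iff {Ω : Type*} {W : ℝ≥0 → Ω → ℝ} {a b : ℝ} {ω : Ω} {t : ℝ≥0}
    (hf : Continuous (W · ω)) (ha : W 0 ω ≠ a) (hb : W 0 ω ≠ b) :
    twoBarrierTime W a b ω ≤ t ↔ hitsFirst (W · ω) a b t ∨ hitsFirst (W · ω) b a t := by
  constructor
  · intro h
    rcases min_le_iff.1 h with h | h
    · rcases firstPassageTime_eq hf ha with ⟨h1, -⟩ | ⟨s, h1, h2, -⟩
      · exact absurd (h1 ▸ h) (WithTop.not_top_le_coe t)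
      · exact hitsFirst_or_hitsFirst hf (WithTop.coe_le_coe.1 (h1 ▸ h)) h2
    · rcases firstPassageTime_eq hf hb with ⟨h1, -⟩ | ⟨s, h1, h2, -⟩
      · exact absurd (h1 ▸ h) (WithTop.not_top_le_coe t)
      · exact (hitsFirst_or_hitsFirst hf (WithTop.coe_le_coe.1 (h1 ▸ h)) h2).symm
  · rintro (⟨s, hs, h, -⟩ | ⟨s, hs, h, -⟩)
    · rcases firstPassageTime_eq hf ha with ⟨-, h2⟩ | ⟨r, h1, -, h3⟩
      · exact (h2 s h).elim
      · exact min_le_of_left_le (h1 ▸ WithTop.coe_le_coe.2 ((h3 s h).trans hs))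
    · rcases firstPassageTime_eq hf hb with ⟨-, h2⟩ | ⟨r, h1, -, h3⟩
      · exact (h2 s h).elim
      · exact min_le_of_right_le (h1 ▸ WithTop.coe_le_coe.2 ((h3 s h).trans hs))

end Path

/-! ### The reflection principle after successive passages. -/

section Reflection

variable {Ω : Type*} {mΩ : MeasurableSpace Ω} {P : Measure Ω} {W : ℝ≥0 → Ω → ℝ}

/-- The σ-algebra generated by the process up to time `u`. -/
abbrev pastSigma (W : ℝ≥0 → Ω → ℝ) (u : ℝ≥0) : MeasurableSpace Ω :=
  MeasurableSpace.comap (fun ω (s : Set.Iic u) ↦ W s ω) inferInstance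

lemma measurable_pastSigma {s u : ℝ≥0} (h : s ≤ u) : Measurable[pastSigma W u] (W s) :=
  (measurable_pi_apply (X := fun _ : Set.Iic u => ℝ) ⟨s, h⟩).comp (comap_measurable _)

lemma pastSigma_mono {u v : ℝ≥0} (h : u ≤ v) : pastSigma W u ≤ pastSigma W v := by
  apply Measurable.comap_le
  exact @measurable_pi_lambda _ _ _ (pastSigma W v) _ _
    fun s => measurable_pastSigma (s.2.trans h)

lemma pastSigma_le (hm : ∀ t, Measurable (W t)) (u : ℝ≥0) : pastSigma W u ≤ mΩ :=
  Measurable.comap_le (measurable_pi_lambda _ fun _ => hm _)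

lemma measurableSet_hitsBy_pastSigma (hc : ∀ ω, Continuous (W · ω)) (l : List ℝ) (u : ℝ≥0) :
    MeasurableSet[pastSigma W u] {ω | hitsBy (W · ω) l u} := by
  induction l generalizing u with
  | nil => simp [hitsBy]
  | cons c l ih =>
    simp_rw [fun ω => hitsBy_cons_iff_denseSeq (c := c) (l := l) (u := u) (hc ω), Set.ofPred_forall,
      Set.ofPred_exists]
    refine @MeasurableSet.iInter _ _ (pastSigma W u) _ _ fun m =>
      @MeasurableSet.iUnion _ _ (pastSigma W u) _ _ fun n => ?_
    refine @MeasurableSet.inter _ (pastSigma W u) _ _ ?_ (pastSigma_mono (min_le_right _ _) _ (ih _))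
    have h : Measurable[pastSigma W u] (W (TopologicalSpace.denseSeq (Set.Iic u) n)) :=
      measurable_pastSigma (TopologicalSpace.denseSeq (Set.Iic u) n).2
    exact (Measurable.comp (g := fun x : ℝ => |x - c|) (by fun_prop) h) measurableSet_Iio

lemma measurableSet_hitsBy (hm : ∀ t, Measurable (W t)) (hc : ∀ ω, Continuous (W · ω))
    (l : List ℝ) (u : ℝ≥0) : MeasurableSet {ω | hitsBy (W · ω) l u} :=
  pastSigma_le hm u _ (measurableSet_hitsBy_pastSigma hc l u)

lemma setIntegral_increment_eq_zero (hB : IsPreBrownianReal W P) (hm : ∀ t, Measurable (W t))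
    {s t : ℝ≥0} (hst : s ≤ t) {E : Set Ω} (hE : MeasurableSet[pastSigma W s] E)
    {g : ℝ → ℝ} (hg : Continuous g) (hodd : ∀ x, g (-x) = - g x) :
    ∫ ω in E, g (W t ω - W s ω) ∂P = 0 := by
  -- The whole process restarted at `s` is independent of the past; its coordinate `t - s` is the
  -- increment.
  have hind : IndepFun (fun ω (s' : Set.Iic s) ↦ W s' ω) (W t - W s) P := by
    have h := (hB.indepFun_shift s).comp (φ := fun x => x (t - s)) (ψ := id)
      (measurable_pi_apply (X := fun _ : ℝ≥0 => ℝ) _) measurable_id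
    have h' : ((fun x : ℝ≥0 → ℝ => x (t - s)) ∘ fun ω t ↦ W (s + t) ω - W s ω) = W t - W s := by
      funext ω
      simp [add_tsub_cancel_of_le hst]
    rw [h'] at h
    exact h.symm
  have hlaw := hB.hasLaw_sub t s
  have h0 : ∫ ω, g ((W t - W s) ω) ∂P = 0 := by
    have h1 : ∫ ω, g ((W t - W s) ω) ∂P = ∫ x, g x ∂(gaussianReal 0 (nndist t.1 s.1)) :=
      hlaw.integral_comp hg.aestronglyMeasurable
    have h2 : ∫ x, g x ∂(gaussianReal 0 (nndist t.1 s.1))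
        = ∫ x, g (-x) ∂(gaussianReal 0 (nndist t.1 s.1)) := by
      generalize nndist t.1 s.1 = v
      have h := gaussianReal_map_neg (μ := 0) (v := v)
      rw [neg_zero] at h
      nth_rw 1 [← h]
      rw [integral_map (by fun_prop) hg.aestronglyMeasurable]
    simp_rw [hodd, integral_neg] at h2
    rw [h1]
    linarith
  have h3 := Indep.setIntegral_eq_mul (P := P) (X := W t - W s) (f := g) (pastSigma_le hm s)
    hind ((hm t).sub (hm s)).aemeasurable hE hg.aestronglyMeasurable
  rw [h0, mul_zero] at h3
  exact h3

/-- `D k` says that the passage time, rounded up to the grid of mesh `t / (N + 1)`, is the `k`-th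
grid point. This is known at that point: the passage has occurred by then, but not by any earlier
grid point. -/
lemma exists_approx_hittingTime (hc : ∀ ω, Continuous (W · ω)) (c : ℝ) (l : List ℝ) {t : ℝ≥0}
    (ht : 0 < t) (N : ℕ) :
    ∃ D : ℕ → Set Ω, (∀ k, k ≤ N + 1 →
        MeasurableSet[pastSigma W (t * (k / (N + 1)))] (D k)) ∧
      (∀ k, D k = {ω | hitsBy (W · ω) (c :: l) (t * (k / (N + 1))) ∧
        ⌈(sInf (hitTimes (W · ω) c l) / t : ℝ) * ((N : ℝ) + 1)⌉₊ = k}) := by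
  refine ⟨_, fun k hk => ?_, fun k => rfl⟩
  have key : {ω | hitsBy (W · ω) (c :: l) (t * (k / (N + 1))) ∧
        ⌈(sInf (hitTimes (W · ω) c l) / t : ℝ) * ((N : ℝ) + 1)⌉₊ = k} =
      {ω | hitsBy (W · ω) (c :: l) (t * (k / (N + 1)))} \
        ⋃ j : Fin k, {ω | hitsBy (W · ω) (c :: l) (t * ((j : ℕ) / (N + 1)))} := by
    ext ω
    simp only [Set.mem_ofPred_eq, Set.mem_sdiff, Set.mem_iUnion, not_exists]
    have hiff : ∀ j : ℕ, sInf (hitTimes (W · ω) c l) ≤ t * (j / (N + 1)) ↔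
        ⌈(sInf (hitTimes (W · ω) c l) / t : ℝ) * ((N : ℝ) + 1)⌉₊ ≤ j := by
      intro j
      rw [Nat.ceil_le, ← NNReal.coe_le_coe]
      push_cast [-NNReal.coe_sInf]
      have ht' : (0 : ℝ) < t := ht
      rw [← mul_div_assoc, le_div_iff₀ (by positivity), div_mul_eq_mul_div, div_le_iff₀ ht',
        mul_comm (t : ℝ)]
    simp only [hitsBy_cons_iff (hc ω), hiff]
    constructor
    · rintro ⟨⟨h1, h2⟩, h3⟩
      exact ⟨⟨h1, h2⟩, fun j h => absurd (h3 ▸ h.2) (by simp)⟩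
    · rintro ⟨⟨h1, h2⟩, h3⟩
      refine ⟨⟨h1, h2⟩, le_antisymm h2 ?_⟩
      by_contra! hlt
      exact h3 ⟨_, hlt⟩ ⟨h1, le_rfl⟩
  rw [key]
  refine (measurableSet_hitsBy_pastSigma hc _ _).diff (MeasurableSet.iUnion fun j => ?_)
  refine pastSigma_mono ?_ _ (measurableSet_hitsBy_pastSigma hc _ _)
  gcongr
  exact j.2.le

lemma setIntegral_hitsBy_eq_zero (hB : IsPreBrownianReal W P) (hm : ∀ t, Measurable (W t))
    (hc : ∀ ω, Continuous (W · ω)) (c : ℝ) (l : List ℝ) {t : ℝ≥0} (ht : 0 < t)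
    {g : ℝ → ℝ} (hg : Continuous g) (hodd : ∀ x, g (-x) = - g x) {C : ℝ} (hC : ∀ x, |g x| ≤ C) :
    ∫ ω in {ω | hitsBy (W · ω) (c :: l) t}, g (W t ω - c) ∂P = 0 := by
  have : IsProbabilityMeasure P := hB.isGaussianProcess.isProbabilityMeasure
  have ht' : (0 : ℝ) < t := ht
  set E := {ω | hitsBy (W · ω) (c :: l) t} with hE
  have hEm : MeasurableSet E := measurableSet_hitsBy hm hc _ _
  choose D hDm hD using exists_approx_hittingTime hc c l ht
  let κ : ℕ → Ω → ℕ := fun N ω => ⌈(sInf (hitTimes (W · ω) c l) / t : ℝ) * ((N : ℝ) + 1)⌉₊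
  -- `F N` is `g (W t - c)` on `E` with `c` replaced by the value of the process at the rounded
  -- passage time. Each summand has zero integral, and path continuity restores `c` in the limit.
  let F : ℕ → Ω → ℝ := fun N ω => ∑ k ∈ Finset.range (N + 2),
    (D N k).indicator (fun ω => g (W t ω - W (t * (k / (N + 1))) ω)) ω
  have hDm' : ∀ N, ∀ k ∈ Finset.range (N + 2), MeasurableSet (D N k) := fun N k hk =>
    pastSigma_le hm _ _ (hDm N k (by have := Finset.mem_range.1 hk; omega))
  have hgm : ∀ N k : ℕ, Measurable (fun ω => g (W t ω - W (t * (k / ((N : ℝ≥0) + 1))) ω)) :=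
    fun N k => hg.measurable.comp ((hm _).sub (hm _))
  have hint : ∀ N, ∫ ω, F N ω ∂P = 0 := by
    intro N
    rw [integral_finsetSum]
    · refine Finset.sum_eq_zero fun k hk => ?_
      rw [integral_indicator (hDm' N k hk)]
      have hk' : k ≤ N + 1 := by have := Finset.mem_range.1 hk; omega
      refine setIntegral_increment_eq_zero hB hm ?_ (hDm N k hk') hg hodd
      refine mul_le_of_le_one_right zero_le (div_le_one_of_le₀ ?_ zero_le)
      exact_mod_cast hk'
    · intro k hk
      refine Integrable.indicator ?_ (hDm' N k hk)
      exact Integrable.of_bound (hgm N k).aestronglyMeasurable C (.of_forall fun ω => hC _)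
  have hFE : ∀ N ω, ω ∈ E → F N ω = g (W t ω - W (t * (κ N ω / (N + 1))) ω) := by
    intro N ω hω
    obtain ⟨h1, h2⟩ := (hitsBy_cons_iff (hc ω)).1 hω
    have h2' : ((sInf (hitTimes (W · ω) c l) : ℝ≥0) : ℝ) ≤ t := h2
    have hle : (sInf (hitTimes (W · ω) c l) / t : ℝ) ≤ 1 := div_le_one_of_le₀ h2' ht'.le
    have hκ : κ N ω ≤ N + 1 := by
      refine Nat.ceil_le.2 ?_
      push_cast [-NNReal.coe_sInf]
      exact mul_le_of_le_one_left (by positivity) hle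
    have hmem : ω ∈ D N (κ N ω) := by
      rw [hD]
      refine ⟨(hitsBy_cons_iff (hc ω)).2 ⟨h1, ?_⟩, rfl⟩
      rw [← NNReal.coe_le_coe]
      push_cast [-NNReal.coe_sInf]
      rw [← mul_div_assoc, le_div_iff₀ (by positivity), ← div_le_iff₀' ht', mul_div_right_comm]
      exact Nat.le_ceil _
    simp only [F]
    rw [Finset.sum_eq_single (κ N ω)]
    · rw [Set.indicator_of_mem hmem]
    · intro k _ hk
      refine Set.indicator_of_notMem ?_ _
      rw [hD]
      exact fun h => hk h.2.symm
    · intro h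
      exact absurd (Finset.mem_range.2 (by omega)) h
  have hFE' : ∀ N ω, ω ∉ E → F N ω = 0 := by
    intro N ω hω
    refine Finset.sum_eq_zero fun k hk => Set.indicator_of_notMem ?_ _
    rw [hD]
    refine fun h => hω (h.1.mono ?_)
    refine mul_le_of_le_one_right zero_le (div_le_one_of_le₀ ?_ zero_le)
    have hk' : k ≤ N + 1 := by have := Finset.mem_range.1 hk; omega
    exact_mod_cast hk'
  have hC0 : 0 ≤ C := (abs_nonneg _).trans (hC 0)
  have hlim : Filter.Tendsto (fun N => ∫ ω, F N ω ∂P) Filter.atTop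
      (nhds (∫ ω, E.indicator (fun ω => g (W t ω - c)) ω ∂P)) := by
    refine tendsto_integral_of_dominated_convergence (fun _ => C) (fun N => ?_)
      (integrable_const C) (fun N => .of_forall fun ω => ?_) (.of_forall fun ω => ?_)
    · refine Measurable.aestronglyMeasurable ?_
      exact Finset.measurable_sum _ fun k hk => (hgm N k).indicator (hDm' N k hk)
    · by_cases hω : ω ∈ E
      · rw [hFE N ω hω]; exact hC _
      · rw [hFE' N ω hω]; simpa using hC0
    · by_cases hω : ω ∈ E
      · simp_rw [hFE _ ω hω, Set.indicator_of_mem hω]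
        obtain ⟨h1, h2⟩ := (hitsBy_cons_iff (hc ω)).1 hω
        have h3 : Filter.Tendsto (fun N : ℕ => t * ((κ N ω : ℝ≥0) / ((N : ℝ≥0) + 1))) Filter.atTop
            (nhds (sInf (hitTimes (W · ω) c l))) := by
          rw [← NNReal.tendsto_coe]
          push_cast [-NNReal.coe_sInf]
          have h4 := ((tendsto_nat_ceil_mul_div_atTop (R := ℝ)
            (a := (sInf (hitTimes (W · ω) c l) / t : ℝ)) (by positivity)).comp
            (tendsto_natCast_atTop_atTop.comp (Filter.tendsto_add_atTop_nat 1))).const_mul (t : ℝ)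
          rw [mul_div_cancel₀ _ ht'.ne'] at h4
          refine h4.congr fun N => ?_
          simp [κ]
        have h5 := ((hc ω).tendsto _).comp h3
        have h6 : (fun s => W s ω) (sInf (hitTimes (W · ω) c l)) = c :=
          apply_sInf_hitTimes (hc ω) h1
        simp only at h6
        rw [h6] at h5
        exact (hg.tendsto _).comp (h5.const_sub (W t ω))
      · simp_rw [hFE' _ ω hω, Set.indicator_of_notMem hω]
        exact tendsto_const_nhds
  simp_rw [hint] at hlim
  rw [← integral_indicator hEm]
  exact (tendsto_nhds_unique hlim tendsto_const_nhds)

/-- **Reflection principle**: after the successive passages through the values in a list, the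
process is symmetric about the last of them. -/
lemma measureReal_hitsBy_reflect (hB : IsPreBrownianReal W P) (hm : ∀ t, Measurable (W t))
    (hc : ∀ ω, Continuous (W · ω)) (c : ℝ) (l : List ℝ) {t : ℝ≥0} (ht : 0 < t) (x : ℝ) :
    P.real {ω | hitsBy (W · ω) (c :: l) t ∧ x < W t ω} =
      P.real {ω | hitsBy (W · ω) (c :: l) t ∧ W t ω < 2 * c - x} := by
  have : IsProbabilityMeasure P := hB.isGaussianProcess.isProbabilityMeasure
  set E := {ω | hitsBy (W · ω) (c :: l) t} with hE
  have hEm : MeasurableSet E := measurableSet_hitsBy hm hc _ _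
  have hX : Measurable fun ω => W t ω - c := (hm t).sub_const c
  have hX' : Measurable fun ω => -(W t ω - c) := hX.neg
  -- Symmetry of the law of `W t - c` on `E` is tested on bounded continuous `g`, through the odd
  -- function `g x - g (-x)`.
  have hmap : (P.restrict E).map (fun ω => W t ω - c) =
      (P.restrict E).map (fun ω => -(W t ω - c)) := by
    have := Measure.isFiniteMeasure_map (P.restrict E) (fun ω => W t ω - c)
    have := Measure.isFiniteMeasure_map (P.restrict E) (fun ω => -(W t ω - c))
    refine ext_of_forall_integral_eq_of_IsFiniteMeasure fun g => ?_
    have hgb := fun x => g.norm_coe_le_norm x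
    rw [integral_map hX.aemeasurable g.continuous.aestronglyMeasurable,
      integral_map hX'.aemeasurable g.continuous.aestronglyMeasurable, ← sub_eq_zero,
      ← integral_sub]
    · refine setIntegral_hitsBy_eq_zero hB hm hc c l ht (g := fun x => g x - g (-x)) (by fun_prop)
        (by simp) (C := ‖g‖ + ‖g‖) fun x => ?_
      exact (abs_sub _ _).trans (add_le_add (hgb x) (hgb (-x)))
    · exact Integrable.of_bound (g.continuous.measurable.comp hX).aestronglyMeasurable ‖g‖
        (.of_forall fun ω => hgb _)
    · exact Integrable.of_bound (g.continuous.measurable.comp hX').aestronglyMeasurable ‖g‖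
        (.of_forall fun ω => hgb _)
  have h := congrArg (fun μ : Measure ℝ => μ.real (Set.Ioi (x - c))) hmap
  rw [map_measureReal_apply hX measurableSet_Ioi, map_measureReal_apply hX' measurableSet_Ioi,
    measureReal_restrict_apply (hX measurableSet_Ioi),
    measureReal_restrict_apply (hX' measurableSet_Ioi)] at h
  convert h using 2
  · ext ω; simp [hE, and_comm]
  · ext ω
    simp only [hE, Set.mem_ofPred_eq, Set.mem_inter_iff, Set.mem_preimage, Set.mem_Ioi, and_comm]
    refine and_congr_left fun _ => ?_
    constructor <;> intro h <;> linarith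

end Reflection

/-! ### Passage to a version that is measurable, continuous and null at `0` everywhere. -/

section Modification

variable {Ω : Type*} {mΩ : MeasurableSpace Ω} {P : Measure Ω} {W : ℝ≥0 → Ω → ℝ}

/-- A Brownian motion is indistinguishable from a measurable one that starts at `0` and all of
whose paths are continuous. -/
lemma exists_continuous_version (hW : IsBrownianReal W P) :
    ∃ V : ℝ≥0 → Ω → ℝ, IsPreBrownianReal V P ∧ (∀ t, Measurable (V t)) ∧
      (∀ ω, Continuous (V · ω)) ∧ (∀ ω, V 0 ω = 0) ∧ ∀ᵐ ω ∂P, ∀ t, W t ω = V t ω := by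
  classical
  let q := TopologicalSpace.denseSeq ℝ≥0
  let M : ℕ → Ω → ℝ := fun n => (hW.aemeasurable (q n)).mk _
  have hM : ∀ n, Measurable (M n) := fun n => (hW.aemeasurable (q n)).measurable_mk
  have hae : ∀ᵐ ω ∂P, Continuous (W · ω) ∧ W 0 ω = 0 ∧ ∀ n, W (q n) ω = M n ω := by
    filter_upwards [hW.cont, hW.eval_zero_ae_eq_zero,
      ae_all_iff.2 fun n => (hW.aemeasurable (q n)).ae_eq_mk] with ω h1 h2 h3
    exact ⟨h1, h2, h3⟩
  obtain ⟨S, hS, hSm, hSP⟩ := exists_measurable_superset_of_null (ae_iff.1 hae)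
  have hgood : ∀ ω ∉ S, Continuous (W · ω) ∧ W 0 ω = 0 ∧ ∀ n, W (q n) ω = M n ω := by
    intro ω hω
    by_contra h
    exact hω (hS h)
  let V : ℝ≥0 → Ω → ℝ := fun t ω => if ω ∈ S then 0 else W t ω
  have hVW : ∀ᵐ ω ∂P, ∀ t, W t ω = V t ω := by
    have : ∀ᵐ ω ∂P, ω ∉ S := measure_eq_zero_iff_ae_notMem.1 hSP
    filter_upwards [this] with ω hω t
    simp [V, hω]
  have hVc : ∀ ω, Continuous (V · ω) := by
    intro ω
    by_cases hω : ω ∈ S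
    · simpa [V, hω] using continuous_const
    · simpa [V, hω] using (hgood ω hω).1
  refine ⟨V, hW.toIsPreBrownianReal.congr fun t => hVW.mono fun ω h => h t, fun t => ?_, hVc,
    fun ω => ?_, hVW⟩
  -- The exceptional set is chosen using only the countably many times `q n`; measurability at any
  -- other time comes from path continuity.
  · have hd : t ∈ closure (Set.range q) := TopologicalSpace.denseRange_denseSeq ℝ≥0 t
    obtain ⟨r, hr, hlim⟩ := mem_closure_iff_seq_limit.1 hd
    refine measurable_of_tendsto_metrizable (f := fun n => V (r n)) (fun n => ?_)
      (tendsto_pi_nhds.2 fun ω => ((hVc ω).tendsto t).comp hlim)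
    obtain ⟨k, hk⟩ := hr n
    have : V (r n) = fun ω => if ω ∈ S then 0 else M k ω := by
      funext ω
      by_cases hω : ω ∈ S
      · simp [V, hω]
      · simp [V, hω, ← hk, (hgood ω hω).2.2 k]
    rw [this]
    exact Measurable.ite hSm measurable_const (hM k)
  · by_cases hω : ω ∈ S
    · simp [V, hω]
    · simp [V, hω, (hgood ω hω).2.1]

end Modification

lemma hitsBy_cons_of_mem_uIcc {f : ℝ≥0 → ℝ} (hf : Continuous f) {l : List ℝ} {c : ℝ} {r t : ℝ≥0}
    (hrt : r ≤ t) (hl : hitsBy f l r) (hc : c ∈ Set.uIcc (f r) (f t)) : hitsBy f (c :: l) t := by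
  obtain ⟨s, hs, hsc⟩ := intermediate_value_uIcc hf.continuousOn hc
  rw [Set.uIcc_of_le hrt] at hs
  exact ⟨s, hs.2, hsc, hl.mono hs.1⟩

/-- The preceding visit is to `b`, or is the starting point when `n = 0`; either way `c` lies
between that value and `f t`, so the intermediate value theorem supplies the crossing. -/
lemma hitsBy_cons_altList_iff {f : ℝ≥0 → ℝ} (hf : Continuous f) {b c : ℝ} {t : ℝ≥0} (n : ℕ)
    (h0 : c ∈ Set.uIcc (f 0) (f t)) (hb : c ∈ Set.uIcc b (f t)) :
    hitsBy f (c :: altList b c n) t ↔ hitsBy f (altList b c n) t := by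
  constructor
  · rintro ⟨s, hs, -, h⟩
    exact h.mono hs
  · intro h
    cases n with
    | zero => exact hitsBy_cons_of_mem_uIcc hf zero_le trivial h0
    | succ n =>
      obtain ⟨r, hr, hrb, h⟩ := h
      exact hitsBy_cons_of_mem_uIcc hf hr ⟨r, le_rfl, hrb, h⟩ (by rwa [hrb])

/-! ### One-dimensional Gaussian marginals. -/

section Gaussian

variable {Ω : Type*} {mΩ : MeasurableSpace Ω} {P : Measure Ω} {W : ℝ≥0 → Ω → ℝ} {t : ℝ≥0}

lemma measureReal_Iic_div_sqrt (hB : IsPreBrownianReal W P) (ht : 0 < t) (x : ℝ) :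
    P.real {ω | W t ω ≤ x} = stdNormalCDF (x / √t) := by
  have hs : 0 < √(t : ℝ) := Real.sqrt_pos.2 ht
  have h := gaussianReal_div_const (hB.hasLaw_eval t) √(t : ℝ)
  have hv : (t / .mk (√(t : ℝ) ^ 2) (sq_nonneg _) : ℝ≥0) = 1 := by
    rw [← NNReal.coe_inj]
    push_cast
    rw [Real.sq_sqrt t.coe_nonneg, div_self (by exact_mod_cast ht.ne')]
  rw [zero_div, hv] at h
  rw [stdNormalCDF, cdf_eq_real, 
    show Set.Iic (x / √(t : ℝ)) = {y | y ≤ x / √(t : ℝ)} from rfl,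
    ← h.measureReal_eq measurableSet_Iic]
  congr 1
  ext ω
  simp [div_le_div_iff_of_pos_right hs]

lemma measure_eq_eq_zero (hB : IsPreBrownianReal W P) (ht : 0 < t) (x : ℝ) :
    P {ω | W t ω = x} = 0 := by
  have := nullSingletonClass_gaussianReal (μ := 0) (v := t) ht.ne'
  rw [(hB.hasLaw_eval t).measure_eq (p := fun y => y = x) (measurableSet_singleton x)]
  exact measure_singleton x

lemma measureReal_Iio_div_sqrt (hB : IsPreBrownianReal W P) (ht : 0 < t) (x : ℝ) :
    P.real {ω | W t ω < x} = stdNormalCDF (x / √t) := by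
  rw [← measureReal_Iic_div_sqrt hB ht]
  refine measureReal_congr ?_
  filter_upwards [measure_eq_zero_iff_ae_notMem.1 (measure_eq_eq_zero hB ht x)] with ω hω
  exact propext ⟨fun h => le_of_lt h, fun h => lt_of_le_of_ne h hω⟩

lemma measureReal_Ioi_div_sqrt (hB : IsPreBrownianReal W P) (ht : 0 < t) (x : ℝ) :
    P.real {ω | x < W t ω} = stdNormalCDF (-x / √t) := by
  rw [← measureReal_Iio_div_sqrt hB.neg ht]
  congr 1
  ext ω
  simp

lemma tendsto_stdNormalCDF_sub_mul (ht : 0 < t) (c : ℝ) {d : ℝ} (hd : 0 < d) :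
    Filter.Tendsto (fun m : ℕ => stdNormalCDF ((c - 2 * (m : ℝ) * d) / √t)) Filter.atTop
      (nhds 0) := by
  have hs : 0 < √(t : ℝ) := Real.sqrt_pos.2 ht
  refine (tendsto_cdf_atBot _).comp (Filter.Tendsto.atBot_div_const hs ?_)
  refine Filter.tendsto_atBot_add_const_left _ c
    (Filter.tendsto_neg_atTop_atBot.comp (Filter.Tendsto.atTop_mul_const hd
      (Filter.Tendsto.const_mul_atTop two_pos tendsto_natCast_atTop_atTop)))

end Gaussian

/-! ### Probabilities of alternating words and the telescoping series. -/

section Alternating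

variable {Ω : Type*} {mΩ : MeasurableSpace Ω} {P : Measure Ω} {W : ℝ≥0 → Ω → ℝ} {t : ℝ≥0}
  {y z : ℝ}

lemma measureReal_hitsBy_altList_Ioi_succ (hB : IsPreBrownianReal W P)
    (hm : ∀ t, Measurable (W t)) (hc : ∀ ω, Continuous (W · ω)) (h0 : ∀ ω, W 0 ω = 0)
    (ht : 0 < t) (hz : z < 0) (hy : 0 < y) (n : ℕ) {x : ℝ} (hx : z ≤ x) :
    P.real {ω | hitsBy (W · ω) (altList z y (n + 1)) t ∧ x < W t ω} =
      P.real {ω | hitsBy (W · ω) (altList y z n) t ∧ W t ω < 2 * z - x} := by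
  rw [altList, measureReal_hitsBy_reflect hB hm hc _ _ ht]
  congr 1
  ext ω
  have hω := h0 ω
  refine and_congr_left fun h => hitsBy_cons_altList_iff (hc ω) n ?_ ?_ <;>
  exact Set.mem_uIcc_of_ge (by linarith) (by linarith)

lemma measureReal_hitsBy_altList_Iio_succ (hB : IsPreBrownianReal W P)
    (hm : ∀ t, Measurable (W t)) (hc : ∀ ω, Continuous (W · ω)) (h0 : ∀ ω, W 0 ω = 0)
    (ht : 0 < t) (hz : z < 0) (hy : 0 < y) (n : ℕ) {x : ℝ} (hx : x ≤ y) :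
    P.real {ω | hitsBy (W · ω) (altList y z (n + 1)) t ∧ W t ω < x} =
      P.real {ω | hitsBy (W · ω) (altList z y n) t ∧ 2 * y - x < W t ω} := by
  have h := measureReal_hitsBy_reflect hB hm hc y (altList z y n) ht (2 * y - x)
  rw [sub_sub_cancel] at h
  rw [altList, ← h]
  congr 1
  ext ω
  have hω := h0 ω
  refine and_congr_left fun h => hitsBy_cons_altList_iff (hc ω) n ?_ ?_ <;>
  exact Set.mem_uIcc_of_le (by linarith) (by linarith)

/-- One reflection at each barrier removes two letters and moves the threshold by `2 (y - z)`. After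
the first reflection the threshold is still on the side required by the second. -/
lemma measureReal_hitsBy_altList_even (hB : IsPreBrownianReal W P)
    (hm : ∀ t, Measurable (W t)) (hc : ∀ ω, Continuous (W · ω)) (h0 : ∀ ω, W 0 ω = 0)
    (ht : 0 < t) (hz : z < 0) (hy : 0 < y) (m : ℕ) :
    (∀ x, z ≤ x → P.real {ω | hitsBy (W · ω) (altList z y (2 * m)) t ∧ x < W t ω} =
      stdNormalCDF ((-x - 2 * (m : ℝ) * (y - z)) / √t)) ∧
    (∀ x, x ≤ y → P.real {ω | hitsBy (W · ω) (altList y z (2 * m)) t ∧ W t ω < x} =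
      stdNormalCDF ((x - 2 * (m : ℝ) * (y - z)) / √t)) := by
  induction m with
  | zero =>
    simp [altList, hitsBy, measureReal_Ioi_div_sqrt hB ht, measureReal_Iio_div_sqrt hB ht]
  | succ m ih =>
    rw [show 2 * (m + 1) = 2 * m + 1 + 1 by ring]
    constructor
    · intro x hx
      rw [measureReal_hitsBy_altList_Ioi_succ hB hm hc h0 ht hz hy _ hx,
        measureReal_hitsBy_altList_Iio_succ hB hm hc h0 ht hz hy _ (by linarith),
        ih.1 _ (by linarith)]
      push_cast
      ring_nf
    · intro x hx
      rw [measureReal_hitsBy_altList_Iio_succ hB hm hc h0 ht hz hy _ hx,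
        measureReal_hitsBy_altList_Ioi_succ hB hm hc h0 ht hz hy _ (by linarith),
        ih.2 _ (by linarith)]
      push_cast
      ring_nf

/-- Reflection with threshold `c` itself makes the two sides equally likely, and `W t = c` is a null
event. This is the source of the factor `2` in the exit series. -/
lemma measureReal_hitsBy_cons (hB : IsPreBrownianReal W P)
    (hm : ∀ t, Measurable (W t)) (hc : ∀ ω, Continuous (W · ω)) (ht : 0 < t) (c : ℝ)
    (l : List ℝ) :
    P.real {ω | hitsBy (W · ω) (c :: l) t} =
        2 * P.real {ω | hitsBy (W · ω) (c :: l) t ∧ c < W t ω} ∧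
      P.real {ω | hitsBy (W · ω) (c :: l) t} =
        2 * P.real {ω | hitsBy (W · ω) (c :: l) t ∧ W t ω < c} := by
  have : IsProbabilityMeasure P := hB.isGaussianProcess.isProbabilityMeasure
  have h := measureReal_hitsBy_reflect hB hm hc c l ht c
  rw [two_mul, add_sub_cancel_right] at h
  have h2 : P.real {ω | hitsBy (W · ω) (c :: l) t} =
      P.real {ω | hitsBy (W · ω) (c :: l) t ∧ c < W t ω} +
      P.real {ω | hitsBy (W · ω) (c :: l) t ∧ W t ω < c} := by
    rw [← measureReal_union]
    · refine measureReal_congr ?_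
      filter_upwards [measure_eq_zero_iff_ae_notMem.1 (measure_eq_eq_zero hB ht c)] with ω hω
      have hω' : W t ω ≠ c := hω
      refine propext ⟨fun h => ?_, fun h => h.elim And.left And.left⟩
      exact hω'.lt_or_gt.elim (fun h' => .inr ⟨h, h'⟩) (fun h' => .inl ⟨h, h'⟩)
    · exact Set.disjoint_left.2 fun ω h1 h2 => lt_asymm h1.2 h2.2
    · have hS : MeasurableSet {ω | W t ω < c} := hm t measurableSet_Iio
      exact (measurableSet_hitsBy hm hc (c :: l) t).inter hS
  constructor <;> linarith

lemma measurableSet_hitsFirst (hm : ∀ t, Measurable (W t)) (hc : ∀ ω, Continuous (W · ω))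
    (a b : ℝ) (t : ℝ≥0) : MeasurableSet {ω | hitsFirst (W · ω) a b t} := by
  let q := TopologicalSpace.denseSeq ℝ≥0
  -- Meeting `a` before `b` fails, once `a` is met by `t`, exactly when at some time of a dense
  -- sequence `b` has been met and `a` has not.
  have key : {ω | hitsFirst (W · ω) a b t} = {ω | hitsBy (W · ω) [a] t} \
      ⋃ n, {ω | hitsBy (W · ω) [b] (q n)} \ {ω | hitsBy (W · ω) [a] (q n)} := by
    ext ω
    simp only [Set.mem_ofPred_eq, Set.mem_sdiff, Set.mem_iUnion, not_exists, not_and, not_not]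
    constructor
    · rintro ⟨s, hs, hsa, h⟩
      refine ⟨⟨s, hs, hsa, trivial⟩, ?_⟩
      rintro n ⟨r, hr, hrb, -⟩
      exact ⟨s, (h r hrb).trans hr, hsa, trivial⟩
    · rintro ⟨⟨s, hs, hsa, -⟩, h⟩
      have hcl : IsClosed {r | W r ω = a} := isClosed_eq (hc ω) continuous_const
      have h1 := hcl.csInf_mem ⟨s, hsa⟩ (OrderBot.bddBelow _)
      have h2 : ∀ r, W r ω = a → sInf {r | W r ω = a} ≤ r :=
        fun r hr => csInf_le (OrderBot.bddBelow _) hr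
      refine ⟨_, (h2 s hsa).trans hs, h1, fun r hr => ?_⟩
      by_contra! hlt
      obtain ⟨p, ⟨hp1, hp2⟩, n, rfl⟩ :=
        (TopologicalSpace.denseRange_denseSeq ℝ≥0).inter_open_nonempty _ isOpen_Ioo
          (Set.nonempty_Ioo.2 hlt)
      obtain ⟨s', hs', hs'a, -⟩ := h n ⟨r, hp1.le, hr, trivial⟩
      exact absurd ((h2 s' hs'a).trans hs') (not_le.2 hp2)
  rw [key]
  exact (measurableSet_hitsBy hm hc _ _).diff (MeasurableSet.iUnion fun n =>
    (measurableSet_hitsBy hm hc _ _).diff (measurableSet_hitsBy hm hc _ _))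

lemma hasSum_measureReal_hitsFirst [IsProbabilityMeasure P] (hm : ∀ t, Measurable (W t))
    (hc : ∀ ω, Continuous (W · ω)) {a b : ℝ} {S : Set Ω}
    (hlim : Filter.Tendsto (fun m : ℕ => P.real {ω | hitsBy (W · ω) (altList a b (2 * m)) t})
      Filter.atTop (nhds 0)) :
    HasSum (fun m : ℕ => P.real ({ω | hitsBy (W · ω) (altList a b (2 * m + 1)) t} ∩ S) -
        P.real ({ω | hitsBy (W · ω) (altList a b (2 * m + 2)) t} ∩ S))
      (P.real ({ω | hitsFirst (W · ω) a b t} ∩ S)) := by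
  set A := {ω | hitsFirst (W · ω) a b t} with hA
  have hAm : MeasurableSet A := measurableSet_hitsFirst hm hc a b t
  let Z : ℕ → Set Ω := fun n => {ω | hitsBy (W · ω) (altList a b n) t}
  let g : ℕ → ℝ := fun m => P.real (Z (2 * m) ∩ S ∩ A)
  have h1 : ∀ m, Z (2 * m + 1) ∩ S ∩ A = Z (2 * m) ∩ S ∩ A := fun m => by
    ext ω
    exact and_congr_left fun h => and_congr_left fun _ => hitsFirst.hitsBy_altList_iff h m
  have h2 : ∀ m, (Z (2 * m + 2) ∩ S) \ A = (Z (2 * m + 1) ∩ S) \ A := fun m => by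
    ext ω
    exact and_congr_left fun h => and_congr_left fun _ =>
      hitsBy_altList_iff_of_not_hitsFirst (hc ω) h m
  -- Each probability is split along `A`: the parts off `A` cancel by `h2`, and `h1` lowers the
  -- index on `A`. Only `A` has to be measurable, not `S`.
  have hterm : ∀ m, P.real (Z (2 * m + 1) ∩ S) - P.real (Z (2 * m + 2) ∩ S) = g m - g (m + 1) := by
    intro m
    rw [← measureReal_inter_add_sdiff (s := Z (2 * m + 1) ∩ S) hAm,
      ← measureReal_inter_add_sdiff (s := Z (2 * m + 2) ∩ S) hAm, h1, h2]
    simp only [g]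
    rw [show 2 * (m + 1) = 2 * m + 2 by ring]
    ring
  -- Monotonicity makes the terms nonnegative, so convergence of the partial sums suffices for
  -- `HasSum`.
  have hanti : ∀ m, g (m + 1) ≤ g m := by
    intro m
    simp only [g]
    rw [← h1 m]
    refine measureReal_mono (Set.inter_subset_inter_left _ (Set.inter_subset_inter_left _ ?_))
    intro ω (h : hitsBy _ _ _)
    rw [show 2 * (m + 1) = 2 * m + 1 + 1 by ring, altList_succ_eq_append] at h
    exact hitsBy_of_append h
  have hg : Filter.Tendsto g Filter.atTop (nhds 0) :=
    squeeze_zero (fun m => measureReal_nonneg)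
      (fun m => measureReal_mono (Set.inter_subset_left.trans Set.inter_subset_left)) hlim
  have hg0 : P.real (A ∩ S) = g 0 := by
    simp only [g, Z]
    congr 1
    ext ω
    simp [altList, hitsBy, and_comm]
  change HasSum (fun m => P.real (Z (2 * m + 1) ∩ S) - P.real (Z (2 * m + 2) ∩ S)) _
  simp_rw [hterm]
  rw [hasSum_iff_tendsto_nat_of_nonneg (fun m => sub_nonneg.2 (hanti m)), hg0]
  simp_rw [Finset.sum_range_sub']
  simpa using hg.const_sub (g 0)

end Alternating

/-! ### The exit series at each barrier. -/

section Exit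

variable {Ω : Type*} {mΩ : MeasurableSpace Ω} {P : Measure Ω} {W : ℝ≥0 → Ω → ℝ} {t : ℝ≥0}
  {y z : ℝ}

lemma measureReal_hitsBy_altList_lower (hB : IsPreBrownianReal W P)
    (hm : ∀ t, Measurable (W t)) (hc : ∀ ω, Continuous (W · ω)) (h0 : ∀ ω, W 0 ω = 0)
    (ht : 0 < t) (hz : z < 0) (hy : 0 < y) (m : ℕ) :
    P.real {ω | hitsBy (W · ω) (altList z y (2 * m + 1)) t} =
        2 * stdNormalCDF ((z - 2 * (m : ℝ) * (y - z)) / √t) ∧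
      P.real {ω | hitsBy (W · ω) (altList z y (2 * m + 2)) t} =
        2 * stdNormalCDF ((-z - 2 * ((m + 1 : ℕ) : ℝ) * (y - z)) / √t) := by
  constructor
  · rw [altList, (measureReal_hitsBy_cons hB hm hc ht _ _).1, ← altList,
      measureReal_hitsBy_altList_Ioi_succ hB hm hc h0 ht hz hy _ le_rfl,
      (measureReal_hitsBy_altList_even hB hm hc h0 ht hz hy m).2 _ (by linarith)]
    ring_nf
  · rw [altList, (measureReal_hitsBy_cons hB hm hc ht _ _).1, ← altList,
      ← (measureReal_hitsBy_altList_even hB hm hc h0 ht hz hy (m + 1)).1 _ le_rfl]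
    rfl

lemma measureReal_hitsBy_altList_upper (hB : IsPreBrownianReal W P)
    (hm : ∀ t, Measurable (W t)) (hc : ∀ ω, Continuous (W · ω)) (h0 : ∀ ω, W 0 ω = 0)
    (ht : 0 < t) (hz : z < 0) (hy : 0 < y) (m : ℕ) :
    P.real {ω | hitsBy (W · ω) (altList y z (2 * m + 1)) t} =
        2 * stdNormalCDF ((-y - 2 * (m : ℝ) * (y - z)) / √t) ∧
      P.real {ω | hitsBy (W · ω) (altList y z (2 * m + 2)) t} =
        2 * stdNormalCDF ((y - 2 * ((m + 1 : ℕ) : ℝ) * (y - z)) / √t) := by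
  constructor
  · rw [altList, (measureReal_hitsBy_cons hB hm hc ht _ _).2, ← altList,
      measureReal_hitsBy_altList_Iio_succ hB hm hc h0 ht hz hy _ le_rfl,
      (measureReal_hitsBy_altList_even hB hm hc h0 ht hz hy m).1 _ (by linarith)]
    ring_nf
  · rw [altList, (measureReal_hitsBy_cons hB hm hc ht _ _).2, ← altList,
      ← (measureReal_hitsBy_altList_even hB hm hc h0 ht hz hy (m + 1)).2 _ le_rfl]
    rfl

/-- The term with `k = j + 1` is the difference between the words of lengths `2j + 1` and `2j + 2`.
With the constraint `x < W t`, an odd word needs one reflection at `z` before the even formula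
applies. -/
lemma hasSum_lowerExit (hB : IsPreBrownianReal W P)
    (hm : ∀ t, Measurable (W t)) (hc : ∀ ω, Continuous (W · ω)) (h0 : ∀ ω, W 0 ω = 0)
    (ht : 0 < t) (hz : z < 0) (hy : 0 < y) :
    HasSum (fun j : ℕ => 2 * lowerExitTerm t y z (j + 1))
        (P.real {ω | hitsFirst (W · ω) z y t}) ∧
      ∀ x, z ≤ x → HasSum (fun j : ℕ => lowerTerm t x y z (j + 1))
        (P.real {ω | hitsFirst (W · ω) z y t ∧ x < W t ω}) := by
  have : IsProbabilityMeasure P := hB.isGaussianProcess.isProbabilityMeasure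
  have hl := measureReal_hitsBy_altList_lower hB hm hc h0 ht hz hy
  have hlim : Filter.Tendsto (fun m : ℕ => P.real {ω | hitsBy (W · ω) (altList z y (2 * m)) t})
      Filter.atTop (nhds 0) := by
    rw [← Filter.tendsto_add_atTop_iff_nat 1]
    have h := ((Filter.tendsto_add_atTop_iff_nat 1).2
      (tendsto_stdNormalCDF_sub_mul ht (-z) (d := y - z) (by linarith))).const_mul 2
    rw [mul_zero] at h
    exact h.congr fun m => (hl m).2.symm
  constructor
  · have h := hasSum_measureReal_hitsFirst (S := Set.univ) hm hc hlim
    simp only [Set.inter_univ] at h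
    refine h.congr_fun ?_
    intro m
    rw [(hl m).1, (hl m).2, lowerExitTerm]
    push_cast
    ring_nf
  · intro x hx
    have h := hasSum_measureReal_hitsFirst (S := {ω | x < W t ω}) hm hc hlim
    refine h.congr_fun ?_
    intro m
    have h1 := measureReal_hitsBy_altList_Ioi_succ hB hm hc h0 ht hz hy (2 * m) hx
    rw [(measureReal_hitsBy_altList_even hB hm hc h0 ht hz hy m).2 _ (by linarith)] at h1
    have h2 := (measureReal_hitsBy_altList_even hB hm hc h0 ht hz hy (m + 1)).1 x hx
    refine Eq.trans ?_ (congrArg₂ (· - ·) h1.symm h2.symm)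
    rw [lowerTerm]
    push_cast
    ring_nf

lemma hasSum_upperExit (hB : IsPreBrownianReal W P)
    (hm : ∀ t, Measurable (W t)) (hc : ∀ ω, Continuous (W · ω)) (h0 : ∀ ω, W 0 ω = 0)
    (ht : 0 < t) (hz : z < 0) (hy : 0 < y) :
    HasSum (fun j : ℕ => 2 * upperExitTerm t y z (j + 1))
        (P.real {ω | hitsFirst (W · ω) y z t}) ∧
      ∀ x, x ≤ y → HasSum (fun j : ℕ => upperTerm t x y z (j + 1))
        (P.real {ω | hitsFirst (W · ω) y z t ∧ W t ω < x}) := by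
  have : IsProbabilityMeasure P := hB.isGaussianProcess.isProbabilityMeasure
  have hl := measureReal_hitsBy_altList_upper hB hm hc h0 ht hz hy
  have hlim : Filter.Tendsto (fun m : ℕ => P.real {ω | hitsBy (W · ω) (altList y z (2 * m)) t})
      Filter.atTop (nhds 0) := by
    rw [← Filter.tendsto_add_atTop_iff_nat 1]
    have h := ((Filter.tendsto_add_atTop_iff_nat 1).2
      (tendsto_stdNormalCDF_sub_mul ht y (d := y - z) (by linarith))).const_mul 2
    rw [mul_zero] at h
    exact h.congr fun m => (hl m).2.symm
  constructor
  · have h := hasSum_measureReal_hitsFirst (S := Set.univ) hm hc hlim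
    simp only [Set.inter_univ] at h
    refine h.congr_fun ?_
    intro m
    rw [(hl m).1, (hl m).2, upperExitTerm]
    push_cast
    ring_nf
  · intro x hx
    have h := hasSum_measureReal_hitsFirst (S := {ω | W t ω < x}) hm hc hlim
    refine h.congr_fun ?_
    intro m
    have h1 := measureReal_hitsBy_altList_Iio_succ hB hm hc h0 ht hz hy (2 * m) hx
    rw [(measureReal_hitsBy_altList_even hB hm hc h0 ht hz hy m).1 _ (by linarith)] at h1
    have h2 := (measureReal_hitsBy_altList_even hB hm hc h0 ht hz hy (m + 1)).2 x hx
    refine Eq.trans ?_ (congrArg₂ (· - ·) h1.symm h2.symm)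
    rw [upperTerm]
    push_cast
    ring_nf

end Exit

/-! ### Assembly of the formulas. -/

/-- Sums over `k ≥ 1` are written as sums over `j : ℕ` with `k = j + 1`. -/
theorem mainTheorem5 {Ω : Type*} [MeasurableSpace Ω] (P : Measure Ω) (W : ℝ≥0 → Ω → ℝ)
    (hW : IsBrownianReal W P) (y z : ℝ) (hz : z < 0) (hy : 0 < y) (t : ℝ≥0) (ht : 0 < t) :
    (∀ x : ℝ, z ≤ x → x ≤ y →
      Summable (fun j : ℕ => upperTerm t x y z (j + 1)) ∧
      Summable (fun j : ℕ => lowerTerm t x y z (j + 1)) ∧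
      P.real {ω | W t ω ≤ x ∧ twoBarrierTime W y z ω ≤ t} =
        P.real {ω | stoppedValue W (twoBarrierTime W y z) ω = z ∧ twoBarrierTime W y z ω ≤ t}
          + ∑' j : ℕ, upperTerm t x y z (j + 1)
          - ∑' j : ℕ, lowerTerm t x y z (j + 1)) ∧
    Summable (fun j : ℕ => lowerExitTerm t y z (j + 1)) ∧
    Summable (fun j : ℕ => upperExitTerm t y z (j + 1)) ∧
    P.real {ω | stoppedValue W (twoBarrierTime W y z) ω = z ∧ twoBarrierTime W y z ω ≤ t} =
      2 * ∑' j : ℕ, lowerExitTerm t y z (j + 1) ∧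
    P.real {ω | stoppedValue W (twoBarrierTime W y z) ω = y ∧ twoBarrierTime W y z ω ≤ t} =
      2 * ∑' j : ℕ, upperExitTerm t y z (j + 1) ∧
    P.real {ω | twoBarrierTime W y z ω ≤ t} =
      2 * ∑' j : ℕ, lowerExitTerm t y z (j + 1)
        + 2 * ∑' j : ℕ, upperExitTerm t y z (j + 1) := by
  obtain ⟨V, hB, hm, hc, h0, hWV⟩ := exists_continuous_version hW
  have : IsProbabilityMeasure P := hB.isGaussianProcess.isProbabilityMeasure
  have hyz : y ≠ z := (hz.trans hy).ne'
  have hpath : ∀ᵐ ω ∂P, W t ω = V t ω ∧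
      ((stoppedValue W (twoBarrierTime W y z) ω = z ∧ twoBarrierTime W y z ω ≤ t) ↔
        hitsFirst (V · ω) z y t) ∧
      ((stoppedValue W (twoBarrierTime W y z) ω = y ∧ twoBarrierTime W y z ω ≤ t) ↔
        hitsFirst (V · ω) y z t) ∧
      (twoBarrierTime W y z ω ≤ t ↔ hitsFirst (V · ω) y z t ∨ hitsFirst (V · ω) z y t) := by
    filter_upwards [hWV] with ω hω
    have hfun : (V · ω) = (W · ω) := funext fun s => (hω s).symm
    have hcont : Continuous (W · ω) := hfun ▸ hc ω
    have hy0 : W 0 ω ≠ y := by rw [hω, h0]; exact hy.ne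
    have hz0 : W 0 ω ≠ z := by rw [hω, h0]; exact hz.ne'
    rw [hfun]
    refine ⟨hω t, ?_, stoppedValue_twoBarrierTime_iff hcont hy0 hz0 hyz,
      twoBarrierTime_le_iff hcont hy0 hz0⟩
    rw [twoBarrierTime_comm]
    exact stoppedValue_twoBarrierTime_iff hcont hz0 hy0 hyz.symm
  have hBm : MeasurableSet {ω | hitsFirst (V · ω) y z t} := measurableSet_hitsFirst hm hc y z t
  have hdisj : Disjoint {ω | hitsFirst (V · ω) z y t} {ω | hitsFirst (V · ω) y z t} :=
    Set.disjoint_left.2 fun ω h => not_hitsFirst_of_hitsFirst hyz.symm h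
  have hlow : P.real {ω | stoppedValue W (twoBarrierTime W y z) ω = z ∧
      twoBarrierTime W y z ω ≤ t} = P.real {ω | hitsFirst (V · ω) z y t} :=
    measureReal_congr (hpath.mono fun ω h => propext h.2.1)
  have hup : P.real {ω | stoppedValue W (twoBarrierTime W y z) ω = y ∧
      twoBarrierTime W y z ω ≤ t} = P.real {ω | hitsFirst (V · ω) y z t} :=
    measureReal_congr (hpath.mono fun ω h => propext h.2.2.1)
  have hexit : P.real {ω | twoBarrierTime W y z ω ≤ t} =
      P.real {ω | hitsFirst (V · ω) z y t} + P.real {ω | hitsFirst (V · ω) y z t} := by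
    rw [← measureReal_union hdisj hBm]
    exact measureReal_congr (hpath.mono fun ω h => propext (h.2.2.2.trans or_comm))
  obtain ⟨hL, hLx⟩ := hasSum_lowerExit hB hm hc h0 ht hz hy
  obtain ⟨hU, hUx⟩ := hasSum_upperExit hB hm hc h0 ht hz hy
  rw [hlow, hup, hexit, ← tsum_mul_left, ← tsum_mul_left, hL.tsum_eq, hU.tsum_eq]
  refine ⟨fun x hzx hxy => ⟨(hUx x hxy).summable, (hLx x hzx).summable, ?_⟩,
    (summable_mul_left_iff two_ne_zero).1 hL.summable,
    (summable_mul_left_iff two_ne_zero).1 hU.summable, rfl, rfl, rfl⟩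
  rw [(hUx x hxy).tsum_eq, (hLx x hzx).tsum_eq]
  have hSm : MeasurableSet {ω | x < V t ω} := hm t measurableSet_Ioi
  have hsplit := measureReal_inter_add_sdiff (μ := P) (s := {ω | hitsFirst (V · ω) z y t}) hSm
  -- The event is split by the barrier met first. The lower part is later written as a complement,
  -- which gives the minus sign before the second series; the upper part may use the strict
  -- inequality because `V t = x` is null.
  have hmain : P.real {ω | W t ω ≤ x ∧ twoBarrierTime W y z ω ≤ t} =
      P.real ({ω | hitsFirst (V · ω) z y t} \ {ω | x < V t ω}) +
        P.real {ω | hitsFirst (V · ω) y z t ∧ V t ω < x} := by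
    have hTm : MeasurableSet {ω | hitsFirst (V · ω) y z t ∧ V t ω < x} :=
      hBm.inter (hm t measurableSet_Iio)
    rw [← measureReal_union (hdisj.mono Set.sdiff_subset fun ω h => h.1) hTm]
    refine measureReal_congr ?_
    filter_upwards [hpath, measure_eq_zero_iff_ae_notMem.1 (measure_eq_eq_zero hB ht x)]
      with ω hω hx
    obtain ⟨h1, -, -, h2⟩ := hω
    have hx' : V t ω ≠ x := hx
    refine propext ?_
    change (W t ω ≤ x ∧ twoBarrierTime W y z ω ≤ t) ↔
      (hitsFirst (V · ω) z y t ∧ ¬ x < V t ω) ∨ (hitsFirst (V · ω) y z t ∧ V t ω < x)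
    rw [h1, h2, not_lt, hx'.le_iff_lt]
    tauto
  have hint : P.real ({ω | hitsFirst (V · ω) z y t} ∩ {ω | x < V t ω}) =
      P.real {ω | hitsFirst (V · ω) z y t ∧ x < V t ω} := rfl
  linarith
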